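/- Let $\omega=(\sqrt5-1)/2$ and, for $\lambda\in\mathbb R$, let $V(n)=\lambda\,\chi_{[1-\omega,1)}(n\omega \bmod 1)$, $n\in\mathbb Z$, be the Fibonacci potential. Let $F_0=F_1=1$, $F_{k+1}=F_k+F_{k-1}$ for $k\ge 1$. For $E\in\mathbb R$ put $$A(n,E)=\begin{pmatrix}E-V(n)&-1\\1&0\end{pmatrix},\qquad M_k(E,\lambda)=A(F_k,E)A(F_k-1,E)\cdots A(1,E),\qquad x_k(E,\lambda)=\operatorname{tr}M_k(E,\lambda),$$ and $\sigma_k=\sigma_k(\lambda)=\{E\in\mathbb R:\ |x_k(E,\lambda)|\le 2\}$. Let $\gamma=\gamma(\lambda)=\dfrac{\log(2\lambda+22)}{\log\omega^{-1}}-1$, and let $|\cdot|$ denote Lebesgue measure. There is an absolute constant $C>0$ such that for every $\lambda>4$ and every integer $k\ge 0$: the set $\sigma_k$ is the union of $F_k$ pairwise disjoint compact intervals, each of which, $I_k$ say, satisfies $$|I_k|\ \ge\ \frac{4}{C(2\lambda+22)^k};$$ moreover, with the same constant $C$, $$|\sigma_k|\ \ge\ \frac4C\,F_k^{-\gamma}.$$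 -/

import Mathlib

open MeasureTheory

noncomputable section

namespace FibHam

/-- The Fibonacci numbers with `F 0 = 1`, `F 1 = 1`, `F (k + 1) = F k + F (k - 1)`. -/
def F (k : ℕ) : ℕ := Nat.fib (k + 1)

/-- The inverse of the golden mean. -/
def ω : ℝ := (Real.sqrt 5 - 1) / 2

/-- The Fibonacci potential `V(n) = lam * χ_[1 - ω, 1) (n ω mod 1)`. -/
def V (lam : ℝ) (n : ℤ) : ℝ :=
  lam * Set.indicator (Set.Ico (1 - ω) 1) (fun _ => (1 : ℝ)) (Int.fract ((n : ℝ) * ω))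

/-- The one-step transfer matrix at site `n` and energy `E`, for the operator
`(H ψ)(n) = ψ(n - 1) + ψ(n + 1) + V(n) ψ(n)`. -/
def A (lam : ℝ) (n : ℤ) (E : ℝ) : Matrix (Fin 2) (Fin 2) ℝ :=
  !![E - V lam n, -1; 1, 0]

/-- The product `A(m + j) * A(m + j - 1) * ⋯ * A(m + 1)` of `j` one-step matrices. -/
def stepProd (lam E : ℝ) (m : ℤ) : ℕ → Matrix (Fin 2) (Fin 2) ℝ
  | 0 => 1
  | j + 1 => A lam (m + (j + 1 : ℕ)) E * stepProd lam E m j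

/-- The transfer matrix `T(n, m; E)`: it is `A(n) * A(n - 1) * ⋯ * A(m + 1)` for `n > m`, the
identity for `n = m`, and the inverse of `T(m, n; E)` for `n < m`. -/
def T (lam : ℝ) (n m : ℤ) (E : ℝ) : Matrix (Fin 2) (Fin 2) ℝ :=
  if m ≤ n then stepProd lam E m (n - m).toNat else (stepProd lam E n (m - n).toNat)⁻¹

/-- The transfer matrix `A(F k) * ⋯ * A(1)` over the sites `1, …, F k`. -/
def M (lam : ℝ) (k : ℕ) (E : ℝ) : Matrix (Fin 2) (Fin 2) ℝ := T lam (F k : ℤ) 0 E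

/-- The trace `x_k(E, lam)`. -/
def x (lam : ℝ) (k : ℕ) (E : ℝ) : ℝ := (M lam k E).trace

/-- The set `σ_k` of the energies `E` with `|x_k(E, lam)| ≤ 2`. -/
def σ (lam : ℝ) (k : ℕ) : Set ℝ := {E : ℝ | |x lam k E| ≤ 2}

/-- The exponent `γ(lam) = log (2 lam + 22) / log (ω⁻¹) - 1`. -/
def γ (lam : ℝ) : ℝ := Real.log (2 * lam + 22) / Real.log ω⁻¹ - 1

end FibHam

end

noncomputable section

namespace FibHam

open Polynomial Set

/-! For $k\ge1$, $x_k$ is `tr` at level $k+1$, a monic polynomial of degree $F_k$; call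
$\{|\mathrm{tr}_n|\le2\}$ the spectrum of level $n$. The trace recursion preserves the Fricke–Vogt
invariant. For $\lambda>4$ this invariant rules out three consecutive traces in $[-2,2]$, while an
escape argument (`abs_le_two_or`) puts each spectrum inside the union of the two preceding ones.

Counting: a band is "adjacent" if it lies in the spectrum one level below, "skip" if two levels
below. Sign changes show that an adjacent band contains a skip band two levels up, and that a skip
band contains an adjacent band one level up and two skip bands two levels up
(`exists_bandFamilies`). The totals equal the degree, so no energy lies outside the bands found
(`setOf_abs_tr_le_eq`).

Lengths: the differentiated invariant controls the derivative of the middle trace by those of its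
neighbours. Through the recursion, the derivative bound on the spectrum grows by at most
$2\lambda+22$ per level (`abs_tr'_le_derivBound`). A band runs between $-2$ and $2$, so the mean
value theorem bounds its length below (`le_length`); summing, with $F_k\ge\omega^{-(k-1)}$, bounds
the measure.

The trace recursion itself holds because the potential nearly repeats under Fibonacci shifts
(`V_add_fib`), a consequence of best approximation by the convergents of $\omega$. -/

/-! ### The trace polynomials -/

/-- The solution of the Fibonacci trace recursion with initial values `2`, `E`, `E - lam`. -/
def tracePoly (lam : ℝ) : ℕ → ℝ[X]
  | 0 => 2
  | 1 => X
  | 2 => X - C lam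
  | n + 3 => tracePoly lam (n + 2) * tracePoly lam (n + 1) - tracePoly lam n

/-- The trace polynomial as a function of the energy. -/
def tr (lam : ℝ) (n : ℕ) (E : ℝ) : ℝ := (tracePoly lam n).eval E

/-- The derivative of the trace polynomial. -/
def tr' (lam : ℝ) (n : ℕ) (E : ℝ) : ℝ := (derivative (tracePoly lam n)).eval E

theorem tr_zero (lam E : ℝ) : tr lam 0 E = 2 := by simp [tr, tracePoly]

theorem tr_one (lam E : ℝ) : tr lam 1 E = E := by simp [tr, tracePoly]

theorem tr_two (lam E : ℝ) : tr lam 2 E = E - lam := by simp [tr, tracePoly]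

theorem tr_rec (lam : ℝ) (n : ℕ) (E : ℝ) :
    tr lam (n + 3) E = tr lam (n + 2) E * tr lam (n + 1) E - tr lam n E := by
  simp [tr, tracePoly]

theorem tr'_zero (lam E : ℝ) : tr' lam 0 E = 0 := by
  have : (2 : ℝ[X]) = C 2 := rfl
  simp [tr', tracePoly, this]

theorem tr'_one (lam E : ℝ) : tr' lam 1 E = 1 := by simp [tr', tracePoly]

theorem tr'_two (lam E : ℝ) : tr' lam 2 E = 1 := by simp [tr', tracePoly]

theorem tr'_rec (lam : ℝ) (n : ℕ) (E : ℝ) :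
    tr' lam (n + 3) E = tr' lam (n + 2) E * tr lam (n + 1) E
      + tr lam (n + 2) E * tr' lam (n + 1) E - tr' lam n E := by
  simp [tr, tr', tracePoly]

theorem continuous_tr (lam : ℝ) (n : ℕ) : Continuous (tr lam n) :=
  (tracePoly lam n).continuous

theorem hasDerivAt_tr (lam : ℝ) (n : ℕ) (E : ℝ) : HasDerivAt (tr lam n) (tr' lam n E) E :=
  (tracePoly lam n).hasDerivAt E

/-- The Fricke–Vogt invariant. -/
theorem tr_invariant (lam : ℝ) (n : ℕ) (E : ℝ) :
    tr lam (n + 2) E ^ 2 + tr lam (n + 1) E ^ 2 + tr lam n E ^ 2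
      - tr lam (n + 2) E * tr lam (n + 1) E * tr lam n E = 4 + lam ^ 2 := by
  induction n with
  | zero => rw [tr_zero, tr_one, tr_two]; ring
  | succ n ih => rw [tr_rec]; linear_combination ih

/-- This is the derivative in $E$ of the Fricke–Vogt identity, with the middle derivative isolated.
-/
theorem tr'_invariant (lam : ℝ) (n : ℕ) (E : ℝ) :
    (2 * tr lam (n + 1) E - tr lam (n + 2) E * tr lam n E) * tr' lam (n + 1) E
      = (tr lam (n + 1) E * tr lam n E - 2 * tr lam (n + 2) E) * tr' lam (n + 2) E
        + (tr lam (n + 2) E * tr lam (n + 1) E - 2 * tr lam n E) * tr' lam n E := by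
  induction n with
  | zero => rw [tr_zero, tr_one, tr_two, tr'_zero, tr'_one, tr'_two]; ring
  | succ n ih => rw [tr_rec, tr'_rec]; linear_combination ih

theorem natDegree_tracePoly (lam : ℝ) (n : ℕ) : (tracePoly lam n).natDegree = Nat.fib n ∧
    (tracePoly lam (n + 1)).Monic ∧ (tracePoly lam (n + 1)).natDegree = Nat.fib (n + 1) ∧
    (tracePoly lam (n + 2)).Monic ∧ (tracePoly lam (n + 2)).natDegree = Nat.fib (n + 2) := by
  induction n with
  | zero =>
    refine ⟨?_, monic_X, natDegree_X, monic_X_sub_C lam, natDegree_X_sub_C lam⟩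
    exact natDegree_C (2 : ℝ)
  | succ n ih =>
    obtain ⟨h0, m1, h1, m2, h2⟩ := ih
    refine ⟨h1, m2, h2, ?_⟩
    have hm := m2.mul m1
    have hd : (tracePoly lam (n + 2) * tracePoly lam (n + 1)).natDegree = Nat.fib (n + 3) := by
      rw [m2.natDegree_mul m1, h1, h2, Nat.fib_add_two (n := n + 1)]; ring
    have hlt : (tracePoly lam n).natDegree
        < (tracePoly lam (n + 2) * tracePoly lam (n + 1)).natDegree := by
      have e3 : Nat.fib (n + 3) = Nat.fib (n + 1) + Nat.fib (n + 2) := Nat.fib_add_two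
      have e2 : Nat.fib (n + 2) = Nat.fib n + Nat.fib (n + 1) := Nat.fib_add_two
      have hpos : 0 < Nat.fib (n + 1) := Nat.fib_pos.2 (Nat.succ_pos n)
      omega
    change (tracePoly lam (n + 3)).Monic ∧ (tracePoly lam (n + 3)).natDegree = Nat.fib (n + 3)
    rw [tracePoly]
    refine ⟨hm.sub_of_left (degree_lt_degree hlt), ?_⟩
    rw [natDegree_sub_eq_left_of_natDegree_lt hlt, hd]

/-! ### Algebra of the invariant surface -/

/-- With all three moduli at most 2, the left side of the invariant is at most
$12+8=20<4+\lambda^2$. -/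
theorem exists_two_lt_abs {lam x y z : ℝ} (hl : 4 < lam)
    (h : x ^ 2 + y ^ 2 + z ^ 2 - x * y * z = 4 + lam ^ 2) (hx : |x| ≤ 2) (hz : |z| ≤ 2) :
    2 < |y| := by
  by_contra! hy
  have hx2 : x ^ 2 ≤ 4 := by nlinarith [sq_abs x, abs_nonneg x]
  have hy2 : y ^ 2 ≤ 4 := by nlinarith [sq_abs y, abs_nonneg y]
  have hz2 : z ^ 2 ≤ 4 := by nlinarith [sq_abs z, abs_nonneg z]
  have hp : |x * y * z| ≤ 2 * 2 * 2 := by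
    rw [abs_mul, abs_mul]; gcongr
  nlinarith [neg_abs_le (x * y * z)]

theorem abs_middle_le {lam x y z : ℝ} (hl : 4 < lam)
    (h : x ^ 2 + y ^ 2 + z ^ 2 - x * y * z = 4 + lam ^ 2) (hx : |x| ≤ 2) (hz : |z| ≤ 2) :
    |y| ≤ lam + 5 / 2 := by
  have hx2 : x ^ 2 ≤ 4 := by nlinarith [sq_abs x, abs_nonneg x]
  have hz2 : z ^ 2 ≤ 4 := by nlinarith [sq_abs z, abs_nonneg z]
  have hp : |x * z| ≤ 2 * 2 := by rw [abs_mul]; gcongr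
  -- Completing the square, $(2y-xz)^2=4\lambda^2+(4-x^2)(4-z^2)\le4\lambda^2+16\le(2\lambda+1)^2$.
  have h1 : |2 * y - x * z| ≤ 2 * lam + 1 := by
    apply abs_le_of_sq_le_sq _ (by linarith)
    nlinarith [mul_nonneg (sq_nonneg x) (sub_nonneg.2 hz2)]
  rw [abs_le] at *
  constructor <;> linarith

/-- On the surface $(2y-xz)^2=4\lambda^2+(4-x^2)(4-z^2)$, and likewise for the other variables.
Since $|y|>2$ and $|x|,|z|\le2$, the coefficient of $y'$ is at least $2\lambda$ in modulus and the
other two are at most $2\lambda$. -/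
theorem abs_deriv_middle_le {lam x y z x' y' z' : ℝ} (hl : 4 < lam)
    (h : x ^ 2 + y ^ 2 + z ^ 2 - x * y * z = 4 + lam ^ 2) (hx : |x| ≤ 2) (hz : |z| ≤ 2)
    (h' : (2 * y - x * z) * y' = (y * z - 2 * x) * x' + (x * y - 2 * z) * z') :
    |y'| ≤ |x'| + |z'| := by
  have hy := exists_two_lt_abs hl h hx hz
  have hx2 : x ^ 2 ≤ 4 := by nlinarith [sq_abs x, abs_nonneg x]
  have hz2 : z ^ 2 ≤ 4 := by nlinarith [sq_abs z, abs_nonneg z]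
  have hy2 : 4 ≤ y ^ 2 := by nlinarith [sq_abs y, abs_nonneg y]
  have h1 : |y * z - 2 * x| ≤ 2 * lam := by
    apply abs_le_of_sq_le_sq _ (by linarith)
    nlinarith [mul_nonneg (sub_nonneg.2 hy2) (sub_nonneg.2 hz2)]
  have h2 : |x * y - 2 * z| ≤ 2 * lam := by
    apply abs_le_of_sq_le_sq _ (by linarith)
    nlinarith [mul_nonneg (sub_nonneg.2 hy2) (sub_nonneg.2 hx2)]
  have h3 : 2 * lam ≤ |2 * y - x * z| := by
    rw [← abs_of_pos (show 0 < 2 * lam by linarith)]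
    apply sq_le_sq.1
    nlinarith [mul_nonneg (sub_nonneg.2 hx2) (sub_nonneg.2 hz2)]
  have h4 : 2 * lam * |y'| ≤ 2 * lam * (|x'| + |z'|) := calc
    2 * lam * |y'| ≤ |2 * y - x * z| * |y'| := by gcongr
    _ = |(y * z - 2 * x) * x' + (x * y - 2 * z) * z'| := by rw [← abs_mul, h']
    _ ≤ |(y * z - 2 * x)| * |x'| + |(x * y - 2 * z)| * |z'| := by
      rw [← abs_mul, ← abs_mul]; exact abs_add_le _ _
    _ ≤ 2 * lam * |x'| + 2 * lam * |z'| := by gcongr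
    _ = _ := by ring
  exact le_of_mul_le_mul_left h4 (by linarith)

/-! ### Bands of consecutive levels, pointwise -/

theorem two_lt_abs_middle {lam : ℝ} (hl : 4 < lam) {n : ℕ} {E : ℝ} (h0 : |tr lam n E| ≤ 2)
    (h2 : |tr lam (n + 2) E| ≤ 2) : 2 < |tr lam (n + 1) E| :=
  exists_two_lt_abs hl (tr_invariant lam n E) h2 h0

theorem two_lt_abs_succ {lam : ℝ} (hl : 4 < lam) {n : ℕ} {E : ℝ} (h0 : |tr lam n E| ≤ 2)
    (h1 : |tr lam (n + 1) E| ≤ 2) : 2 < |tr lam (n + 2) E| := by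
  by_contra! h2
  exact absurd h1 (not_le.2 (two_lt_abs_middle hl h0 h2))

/-- Escape: with two consecutive moduli above 2, the product in the recursion dominates the
subtracted term. The induction starts because level 0 is the constant 2. -/
theorem abs_tr_le_of_two_lt (lam : ℝ) (E : ℝ) (n : ℕ) (h1 : 2 < |tr lam (n + 1) E|)
    (h2 : 2 < |tr lam (n + 2) E|) : |tr lam n E| ≤ |tr lam (n + 2) E| := by
  induction n with
  | zero => rw [tr_zero, abs_two]; exact h2.le
  | succ n ih =>
    rcases le_or_gt |tr lam (n + 1) E| 2 with h0 | h0
    · exact h0.trans h2.le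
    · have h := ih h0 h1
      have h3 : |tr lam (n + 2) E| * |tr lam (n + 1) E| - |tr lam n E| ≤ |tr lam (n + 3) E| := by
        rw [tr_rec, ← abs_mul]; exact abs_sub_abs_le_abs_sub _ _
      change _ ≤ |tr lam (n + 3) E|
      change 2 < |tr lam (n + 2) E| at h1
      nlinarith

/-- If both preceding moduli $a,b$ exceeded 2, with $a$ the later, escape would bound the subtracted
term by $a$, leaving at least $a(b-1)>2$. -/
theorem abs_le_two_or {lam : ℝ} (n : ℕ) {E : ℝ} (h : |tr lam (n + 2) E| ≤ 2) :
    |tr lam (n + 1) E| ≤ 2 ∨ |tr lam n E| ≤ 2 := by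
  cases n with
  | zero => right; rw [tr_zero, abs_two]
  | succ n =>
    by_contra! hc
    obtain ⟨h2, h1⟩ := hc
    have h0 := abs_tr_le_of_two_lt lam E n h1 h2
    have h3 : |tr lam (n + 2) E| * |tr lam (n + 1) E| - |tr lam n E| ≤ |tr lam (n + 3) E| := by
      rw [tr_rec, ← abs_mul]; exact abs_sub_abs_le_abs_sub _ _
    change |tr lam (n + 3) E| ≤ 2 at h
    change 2 < |tr lam (n + 2) E| at h2
    nlinarith

/-! ### Derivative bounds on the spectrum. -/

theorem abs_tr'_middle_le {lam : ℝ} (hl : 4 < lam) {n : ℕ} {E : ℝ} (h0 : |tr lam n E| ≤ 2)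
    (h2 : |tr lam (n + 2) E| ≤ 2) :
    |tr' lam (n + 1) E| ≤ |tr' lam (n + 2) E| + |tr' lam n E| :=
  abs_deriv_middle_le hl (tr_invariant lam n E) h2 h0 (tr'_invariant lam n E)

theorem abs_tr_middle_le {lam : ℝ} (hl : 4 < lam) {n : ℕ} {E : ℝ} (h0 : |tr lam n E| ≤ 2)
    (h2 : |tr lam (n + 2) E| ≤ 2) : |tr lam (n + 1) E| ≤ lam + 5 / 2 :=
  abs_middle_le hl (tr_invariant lam n E) h2 h0

/-- The invariant is symmetric in its three traces, so the large one may equally be the last. -/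
theorem abs_tr'_succ_le {lam : ℝ} (hl : 4 < lam) {n : ℕ} {E : ℝ} (h0 : |tr lam n E| ≤ 2)
    (h1 : |tr lam (n + 1) E| ≤ 2) :
    |tr' lam (n + 2) E| ≤ |tr' lam (n + 1) E| + |tr' lam n E| := by
  refine abs_deriv_middle_le (x := tr lam (n + 1) E) (y := tr lam (n + 2) E) (z := tr lam n E) hl
    ?_ h1 h0 ?_
  · linear_combination tr_invariant lam n E
  · linear_combination tr'_invariant lam n E

/-- The inequality `|(uv)' - w'| ≤ |u'| |v| + |u| |v'| + |w'|` for the trace recursion. -/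
theorem abs_tr'_rec_le (lam : ℝ) (n : ℕ) (E : ℝ) :
    |tr' lam (n + 3) E| ≤ |tr' lam (n + 2) E| * |tr lam (n + 1) E|
      + |tr lam (n + 2) E| * |tr' lam (n + 1) E| + |tr' lam n E| := by
  rw [tr'_rec, ← abs_mul, ← abs_mul]
  exact (abs_sub _ _).trans (by gcongr; exact abs_add_le _ _)

theorem abs_tr'_le_of_adjacent {lam : ℝ} (hl : 4 < lam) {n : ℕ} {E : ℝ} (h0 : |tr lam n E| ≤ 2)
    (h2 : |tr lam (n + 2) E| ≤ 2) :
    |tr' lam (n + 3) E| ≤ (lam + 9 / 2) * |tr' lam (n + 2) E| + 3 * |tr' lam n E| := by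
  have h := abs_tr'_rec_le lam n E
  have hm := abs_tr_middle_le hl h0 h2
  have hm' := abs_tr'_middle_le hl h0 h2
  have e1 : |tr' lam (n + 2) E| * |tr lam (n + 1) E| ≤ |tr' lam (n + 2) E| * (lam + 5 / 2) := by
    gcongr
  have e2 : |tr lam (n + 2) E| * |tr' lam (n + 1) E|
      ≤ 2 * (|tr' lam (n + 2) E| + |tr' lam n E|) := by gcongr
  linarith

theorem abs_tr'_le_of_skip_adjacent {lam : ℝ} (hl : 4 < lam) {n : ℕ} {E : ℝ}
    (h0 : |tr lam n E| ≤ 2) (h1 : |tr lam (n + 1) E| ≤ 2) (h3 : |tr lam (n + 3) E| ≤ 2) :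
    |tr' lam (n + 3) E| ≤ (lam + 9 / 2) * |tr' lam (n + 1) E| + 3 * |tr' lam n E| := by
  have h := abs_tr'_rec_le lam n E
  have hm : |tr lam (n + 2) E| ≤ lam + 5 / 2 := abs_tr_middle_le (n := n + 1) hl h1 h3
  have hm' := abs_tr'_succ_le hl h0 h1
  have e1 : |tr lam (n + 2) E| * |tr' lam (n + 1) E| ≤ (lam + 5 / 2) * |tr' lam (n + 1) E| := by
    gcongr
  have e2 : |tr' lam (n + 2) E| * |tr lam (n + 1) E|
      ≤ (|tr' lam (n + 1) E| + |tr' lam n E|) * 2 := by gcongr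
  linarith

theorem abs_tr'_le_of_skip_skip {lam : ℝ} (hl : 4 < lam) {n : ℕ} {E : ℝ}
    (h0 : |tr lam n E| ≤ 2) (h2 : |tr lam (n + 2) E| ≤ 2) (h4 : |tr lam (n + 4) E| ≤ 2) :
    |tr' lam (n + 4) E| ≤ (3 * lam + 25 / 2) * |tr' lam (n + 2) E| + 7 * |tr' lam n E| := by
  have h : |tr' lam (n + 4) E| ≤ |tr' lam (n + 3) E| * |tr lam (n + 2) E|
      + |tr lam (n + 3) E| * |tr' lam (n + 2) E| + |tr' lam (n + 1) E| :=
    abs_tr'_rec_le lam (n + 1) E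
  have hm : |tr lam (n + 3) E| ≤ lam + 5 / 2 := abs_tr_middle_le (n := n + 2) hl h2 h4
  have hm' := abs_tr'_middle_le hl h0 h2
  have e1 : |tr lam (n + 3) E| * |tr' lam (n + 2) E| ≤ (lam + 5 / 2) * |tr' lam (n + 2) E| := by
    gcongr
  have e2 : |tr' lam (n + 3) E| * |tr lam (n + 2) E|
      ≤ ((lam + 9 / 2) * |tr' lam (n + 2) E| + 3 * |tr' lam n E|) * 2 := by
    have := abs_tr'_le_of_adjacent hl h0 h2
    gcongr
  linarith

/-- The bound `(2 lam + 22) ^ (n - 2)` for the derivative at level `n`, with its initial values. -/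
def derivBound (lam : ℝ) : ℕ → ℝ
  | 0 => 0
  | 1 => 1
  | n + 2 => (2 * lam + 22) ^ n

theorem derivBound_nonneg {lam : ℝ} (hl : 4 < lam) (n : ℕ) : 0 ≤ derivBound lam n := by
  rcases n with _ | _ | n
  · exact le_rfl
  · exact zero_le_one
  · exact pow_nonneg (by linarith) n

theorem derivBound_mono {lam : ℝ} (hl : 4 < lam) (n : ℕ) :
    derivBound lam n ≤ derivBound lam (n + 1) := by
  rcases n with _ | _ | n
  · exact zero_le_one
  · simp [derivBound]
  · exact pow_le_pow_right₀ (by linarith) (Nat.le_succ n)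

theorem derivBound_succ {lam : ℝ} (n : ℕ) :
    derivBound lam (n + 3) = (2 * lam + 22) * derivBound lam (n + 2) :=
  pow_succ' _ _

/-- Below level $n+3$ the energy also lies in the spectra of levels $\{n+2,n\}$, $\{n+1,n\}$ or
$\{n+1,n-1\}$: `abs_le_two_or` and the exclusion of three consecutive levels leave no other case.
Each case has its own recursive estimate. -/
theorem abs_tr'_le_derivBound {lam : ℝ} (hl : 4 < lam) (E : ℝ) (n : ℕ) (h : |tr lam n E| ≤ 2) :
    |tr' lam n E| ≤ derivBound lam n := by
  induction n using Nat.strong_induction_on with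
  | _ n ih =>
    rcases n with _ | _ | _ | n
    · simp [tr'_zero, derivBound]
    · simp [tr'_one, derivBound]
    · simp [tr'_two, derivBound]
    change |tr lam (n + 3) E| ≤ 2 at h
    change |tr' lam (n + 3) E| ≤ derivBound lam (n + 3)
    have m0 := derivBound_mono hl n
    have m1 := derivBound_mono hl (n + 1)
    have p0 := derivBound_nonneg hl n
    have p1 := derivBound_nonneg hl (n + 1)
    have p2 := derivBound_nonneg hl (n + 2)
    rw [derivBound_succ]
    rcases abs_le_two_or (n + 1) h with h2 | h1
    · change |tr lam (n + 2) E| ≤ 2 at h2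
      have h1 : 2 < |tr lam (n + 1) E| := by
        by_contra! h1
        exact absurd h (not_le.2 (two_lt_abs_succ (n := n + 1) hl h1 h2))
      have h0 := (abs_le_two_or n h2).resolve_left (not_le.2 h1)
      have b := abs_tr'_le_of_adjacent hl h0 h2
      have b2 := ih (n + 2) (by omega) h2
      have b0 := ih n (by omega) h0
      have : (lam + 9 / 2) * |tr' lam (n + 2) E| ≤ (lam + 9 / 2) * derivBound lam (n + 2) := by
        gcongr
      nlinarith
    · have b1 := ih (n + 1) (by omega) h1
      rcases le_or_gt |tr lam n E| 2 with h0 | h0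
      · have b := abs_tr'_le_of_skip_adjacent hl h0 h1 h
        have b0 := ih n (by omega) h0
        have : (lam + 9 / 2) * |tr' lam (n + 1) E| ≤ (lam + 9 / 2) * derivBound lam (n + 1) := by
          gcongr
        nlinarith
      · rcases n with _ | n
        · rw [tr_zero, abs_two] at h0
          exact absurd h0 (lt_irrefl _)
        have hn := (abs_le_two_or n h1).resolve_left (not_le.2 h0)
        have b := abs_tr'_le_of_skip_skip hl hn h1 h
        have b0 := ih n (by omega) hn
        have mn := derivBound_mono hl n
        have pn := derivBound_nonneg hl n
        have e : derivBound lam (n + 1 + 2) = (2 * lam + 22) * derivBound lam (n + 2) :=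
          derivBound_succ n
        change |tr' lam (n + 2) E| ≤ derivBound lam (n + 2) at b1
        change derivBound lam (n + 1) ≤ derivBound lam (n + 2) at m0
        change 0 ≤ derivBound lam (n + 2) at p1
        change |tr' lam (n + 4) E| ≤ _
        have : (3 * lam + 25 / 2) * |tr' lam (n + 2) E|
            ≤ (3 * lam + 25 / 2) * derivBound lam (n + 2) := by gcongr
        -- Two levels are gained over `derivBound lam (n + 2)`, so the available factor is
        -- $(2\lambda+22)^2$, more than $3\lambda+25/2+7$.
        rw [e]
        nlinarith [mul_nonneg (sq_nonneg lam) p1]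

end FibHam

end

noncomputable section

namespace FibHam

open Set

/-! ### Crossings of a continuous function -/

/-- The function `f` stays in `[-2, 2]` on `[a, b]` and has opposite extreme values at the ends. -/
structure IsCrossing (f : ℝ → ℝ) (a b : ℝ) : Prop where
  lt : a < b
  abs_le_two : ∀ E ∈ Icc a b, |f E| ≤ 2
  mul_eq : f a * f b = -4

theorem IsCrossing.neg {f : ℝ → ℝ} {a b : ℝ} (h : IsCrossing (fun E => -f E) a b) :
    IsCrossing f a b :=
  ⟨h.lt, fun E hE => by simpa using h.abs_le_two E hE, by simpa using h.mul_eq⟩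

theorem IsCrossing.sq_left {f : ℝ → ℝ} {a b : ℝ} (h : IsCrossing f a b) : f a ^ 2 = 4 := by
  have h1 := abs_le.1 (h.abs_le_two a (left_mem_Icc.2 h.lt.le))
  have h2 := abs_le.1 (h.abs_le_two b (right_mem_Icc.2 h.lt.le))
  have h3 := h.mul_eq
  have : f a ^ 2 ≤ 4 := by nlinarith
  have : f b ^ 2 ≤ 4 := by nlinarith
  nlinarith

theorem IsCrossing.sq_right {f : ℝ → ℝ} {a b : ℝ} (h : IsCrossing f a b) : f b ^ 2 = 4 := by
  have h3 := h.mul_eq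
  have h4 := h.sq_left
  nlinarith [congrArg (· ^ 2) h3]

theorem IsCrossing.cases {f : ℝ → ℝ} {a b : ℝ} (h : IsCrossing f a b) :
    f a = -2 ∧ f b = 2 ∨ f a = 2 ∧ f b = -2 := by
  have h3 := h.mul_eq
  have h4 : (f a + 2) * (f a - 2) = 0 := by linear_combination h.sq_left
  rcases mul_eq_zero.1 h4 with h5 | h5
  · left
    have h6 : f a = -2 := by linarith
    exact ⟨h6, by rw [h6] at h3; linarith⟩
  · right
    have h6 : f a = 2 := by linarith
    exact ⟨h6, by rw [h6] at h3; linarith⟩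

theorem IsCrossing.exists_eq {f : ℝ → ℝ} (hf : Continuous f) {a b : ℝ} (h : IsCrossing f a b)
    {c : ℝ} (hc : |c| ≤ 2) : ∃ E ∈ Icc a b, f E = c := by
  have hc := abs_le.1 hc
  rcases h.cases with ⟨h1, h2⟩ | ⟨h1, h2⟩
  · exact intermediate_value_Icc h.lt.le hf.continuousOn (by rw [h1, h2]; exact hc)
  · exact intermediate_value_Icc' h.lt.le hf.continuousOn (by rw [h1, h2]; exact hc)

/-- Take $d$ to be the first point where $f=2$ and $c$ the last point before $d$ where $f=-2$;
between them $f$ cannot leave $[-2,2]$. -/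
theorem exists_isCrossing_of_lt {f : ℝ → ℝ} (hf : Continuous f) {a b : ℝ} (hab : a < b)
    (ha : f a < -2) (hb : 2 < f b) : ∃ c d, a < c ∧ d < b ∧ IsCrossing f c d := by
  obtain ⟨e, he, hfe⟩ : ∃ e ∈ Icc a b, f e = 2 :=
    intermediate_value_Icc hab.le hf.continuousOn ⟨by linarith, hb.le⟩
  obtain ⟨d, ⟨hd, hfd⟩, hdmin⟩ : ∃ d, IsLeast (Icc a b ∩ f ⁻¹' {2}) d :=
    (isCompact_Icc.inter_right (isClosed_singleton.preimage hf)).exists_isLeast ⟨e, he, hfe⟩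
  have hfd : f d = 2 := hfd
  obtain ⟨e', he', hfe'⟩ : ∃ e ∈ Icc a d, f e = -2 :=
    intermediate_value_Icc hd.1 hf.continuousOn ⟨ha.le, by linarith⟩
  obtain ⟨c, ⟨hc, hfc⟩, hcmax⟩ : ∃ c, IsGreatest (Icc a d ∩ f ⁻¹' {-2}) c :=
    (isCompact_Icc.inter_right (isClosed_singleton.preimage hf)).exists_isGreatest ⟨e', he', hfe'⟩
  have hfc : f c = -2 := hfc
  have hcd : c < d := lt_of_le_of_ne hc.2 (by rintro rfl; linarith)
  refine ⟨c, d, lt_of_le_of_ne hc.1 (by rintro rfl; linarith),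
    lt_of_le_of_ne hd.2 (by rintro rfl; linarith), hcd, fun E hE => abs_le.2 ⟨?_, ?_⟩,
    by rw [hfc, hfd]; norm_num⟩
  · by_contra! hlt
    obtain ⟨g, hg, hfg⟩ : ∃ g ∈ Icc E d, f g = -2 :=
      intermediate_value_Icc hE.2 hf.continuousOn ⟨hlt.le, by linarith⟩
    have hgc : g ≤ c := hcmax ⟨⟨hc.1.trans (hE.1.trans hg.1), hg.2⟩, hfg⟩
    have : E = c := le_antisymm (hg.1.trans hgc) hE.1
    rw [this] at hlt
    linarith
  · by_contra! hlt
    obtain ⟨g, hg, hfg⟩ : ∃ g ∈ Icc c E, f g = 2 :=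
      intermediate_value_Icc hE.1 hf.continuousOn ⟨by linarith, hlt.le⟩
    have hdg : d ≤ g := hdmin ⟨⟨hc.1.trans hg.1, hg.2.trans (hE.2.trans hd.2)⟩, hfg⟩
    have : E = d := le_antisymm hE.2 (hdg.trans hg.2)
    rw [this] at hlt
    linarith

theorem exists_isCrossing {f : ℝ → ℝ} (hf : Continuous f) {a b : ℝ} (hab : a < b)
    (ha : 2 < |f a|) (hb : 2 < |f b|) (hs : f a * f b < 0) :
    ∃ c d, a < c ∧ d < b ∧ IsCrossing f c d := by
  rcases lt_abs.1 ha with ha | ha <;> rcases lt_abs.1 hb with hb | hb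
  · nlinarith
  · obtain ⟨c, d, h1, h2, h3⟩ := exists_isCrossing_of_lt (f := fun E => -f E) hf.neg hab
      (by linarith) (by linarith)
    exact ⟨c, d, h1, h2, h3.neg⟩
  · exact exists_isCrossing_of_lt hf hab (by linarith) hb
  · nlinarith

theorem mul_pos_of_two_lt_abs {f : ℝ → ℝ} (hf : Continuous f) {a b : ℝ}
    (h : ∀ E ∈ Icc a b, 2 < |f E|) {c d : ℝ} (hc : c ∈ Icc a b) (hd : d ∈ Icc a b) :
    0 < f c * f d := by
  by_contra! hle
  obtain ⟨E, hE, h0⟩ : ∃ E ∈ uIcc c d, f E = 0 := by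
    have := intermediate_value_uIcc (a := c) (b := d) hf.continuousOn
    apply this
    rw [mem_uIcc]
    rcases mul_nonpos_iff.1 hle with h | h
    · exact Or.inr ⟨h.2, h.1⟩
    · exact Or.inl h
  have := h E (ordConnected_Icc.uIcc_subset hc hd hE)
  rw [h0, abs_zero] at this
  linarith

/-- If `w` crosses over an interval on which `|y| > 2` and `|u| ≤ 2`, then so does `y w - u`. -/
theorem IsCrossing.exists_mul_sub {w y u z : ℝ → ℝ} (hy : Continuous y) (hz : Continuous z)
    {a b : ℝ} (hw : IsCrossing w a b) (hyab : ∀ E ∈ Icc a b, 2 < |y E|)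
    (hu : ∀ E ∈ Icc a b, |u E| ≤ 2) (hzw : ∀ E, z E = y E * w E - u E) :
    ∃ c d, a < c ∧ d < b ∧ IsCrossing z c d := by
  have ma := left_mem_Icc.2 hw.lt.le
  have mb := right_mem_Icc.2 hw.lt.le
  have ya := hyab a ma
  have yb := hyab b mb
  have ua := abs_le.1 (hu a ma)
  have ub := abs_le.1 (hu b mb)
  have hpos := mul_pos_of_two_lt_abs hy hyab ma mb
  -- At the ends $z=\pm2y-u$ with opposite signs, $|2y|>4$ and $|u|\le2$, while $y$ keeps its sign.
  have key : 2 < |z a| ∧ 2 < |z b| ∧ z a * z b < 0 := by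
    rw [hzw a, hzw b]
    rcases lt_abs.1 ya with ya | ya <;> rcases lt_abs.1 yb with yb | yb
    · rcases hw.cases with ⟨h1, h2⟩ | ⟨h1, h2⟩ <;> rw [h1, h2]
      · exact ⟨lt_abs.2 (Or.inr (by linarith)), lt_abs.2 (Or.inl (by linarith)),
          mul_neg_of_neg_of_pos (by linarith) (by linarith)⟩
      · exact ⟨lt_abs.2 (Or.inl (by linarith)), lt_abs.2 (Or.inr (by linarith)),
          mul_neg_of_pos_of_neg (by linarith) (by linarith)⟩
    · nlinarith
    · nlinarith
    · rcases hw.cases with ⟨h1, h2⟩ | ⟨h1, h2⟩ <;> rw [h1, h2]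
      · exact ⟨lt_abs.2 (Or.inl (by linarith)), lt_abs.2 (Or.inr (by linarith)),
          mul_neg_of_pos_of_neg (by linarith) (by linarith)⟩
      · exact ⟨lt_abs.2 (Or.inr (by linarith)), lt_abs.2 (Or.inl (by linarith)),
          mul_neg_of_neg_of_pos (by linarith) (by linarith)⟩
  exact exists_isCrossing hz hw.lt key.1 key.2.1 key.2.2

/-! ### Families of bands -/

/-- A finite family of disjoint bands of level `n` contained in the spectrum of level `m`. -/
structure IsBandFamily (lam : ℝ) (n m : ℕ) (S : Finset (ℝ × ℝ)) : Prop where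
  crossing : ∀ p ∈ S, IsCrossing (tr lam n) p.1 p.2
  abs_le_two : ∀ p ∈ S, ∀ E ∈ Icc p.1 p.2, |tr lam m E| ≤ 2
  disj : (S : Set (ℝ × ℝ)).PairwiseDisjoint (fun p => Icc p.1 p.2)

/-- Children of different parents are disjoint because the parents are, so the counts multiply. -/
theorem IsBandFamily.refine {lam : ℝ} {n m n' m' N : ℕ} {S : Finset (ℝ × ℝ)}
    (hS : IsBandFamily lam n m S)
    (h : ∀ p ∈ S, ∃ T : Finset (ℝ × ℝ), T.card = N ∧ IsBandFamily lam n' m' T ∧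
      ∀ q ∈ T, Icc q.1 q.2 ⊆ Icc p.1 p.2) :
    ∃ T : Finset (ℝ × ℝ), T.card = N * S.card ∧ IsBandFamily lam n' m' T ∧
      ∀ q ∈ T, ∃ p ∈ S, Icc q.1 q.2 ⊆ Icc p.1 p.2 := by
  classical
  choose! t hcard hfam hsub using h
  refine ⟨S.biUnion t, ?_, ⟨?_, ?_, ?_⟩, ?_⟩
  · rw [Finset.card_biUnion, Finset.sum_congr rfl hcard, Finset.sum_const, smul_eq_mul, mul_comm]
    intro p hp p' hp' hne
    rw [Function.onFun, Finset.disjoint_left]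
    intro q hq hq'
    have mq := left_mem_Icc.2 ((hfam p hp).crossing q hq).lt.le
    exact (hS.disj hp hp' hne).le_bot ⟨hsub p hp q hq mq, hsub p' hp' q hq' mq⟩
  · intro q hq
    obtain ⟨p, hp, hq⟩ := Finset.mem_biUnion.1 hq
    exact (hfam p hp).crossing q hq
  · intro q hq
    obtain ⟨p, hp, hq⟩ := Finset.mem_biUnion.1 hq
    exact (hfam p hp).abs_le_two q hq
  · intro q hq q' hq' hne
    obtain ⟨p, hp, hq⟩ := Finset.mem_biUnion.1 hq
    obtain ⟨p', hp', hq'⟩ := Finset.mem_biUnion.1 hq'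
    by_cases hpp : p = p'
    · subst hpp
      exact (hfam p hp).disj hq hq' hne
    · exact (hS.disj hp hp' hpp).mono (hsub p hp q hq) (hsub p' hp' q' hq')
  · intro q hq
    obtain ⟨p, hp, hq⟩ := Finset.mem_biUnion.1 hq
    exact ⟨p, hp, hsub p hp q hq⟩

theorem IsBandFamily.union [DecidableEq (ℝ × ℝ)] {lam : ℝ} {n m m' : ℕ} {S T : Finset (ℝ × ℝ)}
    (hS : IsBandFamily lam n m S) (hT : IsBandFamily lam n m' T)
    (h : ∀ p ∈ S, ∀ q ∈ T, Disjoint (Icc p.1 p.2) (Icc q.1 q.2)) :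
    (S ∪ T).card = S.card + T.card ∧ (∀ p ∈ S ∪ T, IsCrossing (tr lam n) p.1 p.2) ∧
      ((S ∪ T : Finset (ℝ × ℝ)) : Set (ℝ × ℝ)).PairwiseDisjoint (fun p => Icc p.1 p.2) := by
  refine ⟨Finset.card_union_of_disjoint (Finset.disjoint_left.2 fun p hp hp' => ?_), ?_, ?_⟩
  · have mp := left_mem_Icc.2 (hS.crossing p hp).lt.le
    exact (h p hp p hp').le_bot ⟨mp, mp⟩
  · intro p hp
    exact (Finset.mem_union.1 hp).elim (hS.crossing p) (hT.crossing p)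
  · intro p hp q hq hne
    rcases Finset.mem_union.1 hp with hp | hp <;> rcases Finset.mem_union.1 hq with hq | hq
    · exact hS.disj hp hq hne
    · exact h p hp q hq
    · exact (h q hq p hp).symm
    · exact hT.disj hp hq hne

theorem isBandFamily_singleton {lam : ℝ} {n m : ℕ} {a b : ℝ} (h : IsCrossing (tr lam n) a b)
    (h' : ∀ E ∈ Icc a b, |tr lam m E| ≤ 2) : IsBandFamily lam n m {(a, b)} := by
  refine ⟨by simpa using h, by simpa using h', by simp⟩

/-- A band of level `n + 1` inside the spectrum of level `n` contains a band of level `n + 3`. -/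
theorem exists_skip_band {lam : ℝ} (hl : 4 < lam) (n : ℕ) {a b : ℝ}
    (h : IsCrossing (tr lam (n + 1)) a b) (h' : ∀ E ∈ Icc a b, |tr lam n E| ≤ 2) :
    ∃ T : Finset (ℝ × ℝ), T.card = 1 ∧ IsBandFamily lam (n + 3) (n + 1) T ∧
      ∀ q ∈ T, Icc q.1 q.2 ⊆ Icc a b := by
  obtain ⟨c, d, hc, hd, hcd⟩ := h.exists_mul_sub (continuous_tr lam (n + 2))
    (continuous_tr lam (n + 3)) (fun E hE => two_lt_abs_succ hl (h' E hE) (h.abs_le_two E hE)) h'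
    (tr_rec lam n)
  have hsub : Icc c d ⊆ Icc a b := Icc_subset_Icc hc.le hd.le
  exact ⟨{(c, d)}, rfl, isBandFamily_singleton hcd fun E hE => h.abs_le_two E (hsub hE), by simpa⟩

theorem IsCrossing.exists_next {lam : ℝ} (hl : 4 < lam) (n : ℕ) {a b : ℝ}
    (h : IsCrossing (tr lam (n + 2)) a b) (h' : ∀ E ∈ Icc a b, |tr lam n E| ≤ 2) :
    ∃ c d, a < c ∧ d < b ∧ IsCrossing (tr lam (n + 3)) c d :=
  h.exists_mul_sub (continuous_tr lam (n + 1)) (continuous_tr lam (n + 3))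
    (fun E hE => two_lt_abs_middle hl (h' E hE) (h.abs_le_two E hE)) h'
    (fun E => by rw [tr_rec, mul_comm])

/-- A band of level `n + 2` inside the spectrum of level `n` contains a band of level `n + 3`. -/
theorem exists_next_band {lam : ℝ} (hl : 4 < lam) (n : ℕ) {a b : ℝ}
    (h : IsCrossing (tr lam (n + 2)) a b) (h' : ∀ E ∈ Icc a b, |tr lam n E| ≤ 2) :
    ∃ T : Finset (ℝ × ℝ), T.card = 1 ∧ IsBandFamily lam (n + 3) (n + 2) T ∧
      ∀ q ∈ T, Icc q.1 q.2 ⊆ Icc a b := by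
  obtain ⟨c, d, hc, hd, hcd⟩ := h.exists_next hl n h'
  have hsub : Icc c d ⊆ Icc a b := Icc_subset_Icc hc.le hd.le
  exact ⟨{(c, d)}, rfl, isBandFamily_singleton hcd fun E hE => h.abs_le_two E (hsub hE), by simpa⟩

/-- At an edge of a band of level `n + 2` in the spectrum of level `n`, the traces of levels `n + 1`
and `n + 4` have the same sign. -/
theorem tr_mul_pos_of_sq {lam : ℝ} (hl : 4 < lam) {n : ℕ} {E : ℝ} (h : tr lam (n + 2) E ^ 2 = 4)
    (h' : |tr lam n E| ≤ 2) : 2 < |tr lam (n + 4) E| ∧ 0 < tr lam (n + 4) E * tr lam (n + 1) E := by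
  have hi := tr_invariant lam n E
  have e4 : tr lam (n + 4) E = tr lam (n + 3) E * tr lam (n + 2) E - tr lam (n + 1) E :=
    tr_rec lam (n + 1) E
  have e3 := tr_rec lam n E
  set u := tr lam n E
  set y := tr lam (n + 1) E
  set w := tr lam (n + 2) E
  have hwu : |w * u| ≤ 2 * 2 := by
    rw [abs_mul]
    gcongr
    exact abs_le_of_sq_le_sq (by linarith) (by norm_num)
  have hwu := abs_le.1 hwu
  have e : tr lam (n + 4) E = 3 * y - w * u := by
    rw [e4, e3]; linear_combination y * h
  -- Since $w^2=4$, the invariant factors and $y=wu/2\pm\lambda$. As $|wu/2|\le2$, the term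
  -- $\pm\lambda$ decides the sign of both $y$ and $3y-wu=wu/2\pm3\lambda$.
  have hf : (y - w * u / 2 - lam) * (y - w * u / 2 + lam) = 0 := by
    linear_combination hi - h + u ^ 2 / 4 * h
  rcases mul_eq_zero.1 hf with hy | hy
  · have h1 : 2 < tr lam (n + 4) E := by linarith
    exact ⟨lt_abs.2 (Or.inl h1), mul_pos (by linarith) (by linarith)⟩
  · have h1 : tr lam (n + 4) E < -2 := by linarith
    exact ⟨lt_abs.2 (Or.inr (by linarith)), mul_pos_of_neg_of_neg (by linarith) (by linarith)⟩

/-- On the intersection of the spectra of levels `n + 1` and `n + 2`, the traces of levels `n` and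
`n + 3` have opposite signs. -/
theorem tr_mul_neg {lam : ℝ} (hl : 4 < lam) {n : ℕ} {E : ℝ} (h1 : |tr lam (n + 1) E| ≤ 2)
    (h2 : |tr lam (n + 2) E| ≤ 2) : tr lam (n + 3) E * tr lam n E < 0 := by
  have hi := tr_invariant lam n E
  rw [tr_rec]
  have hx2 : tr lam (n + 1) E ^ 2 ≤ 4 := by
    nlinarith [sq_abs (tr lam (n + 1) E), abs_nonneg (tr lam (n + 1) E)]
  have hz2 : tr lam (n + 2) E ^ 2 ≤ 4 := by
    nlinarith [sq_abs (tr lam (n + 2) E), abs_nonneg (tr lam (n + 2) E)]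
  -- By the invariant, the product equals the sum of the squares of the two middle traces minus
  -- $4+\lambda^2$, hence at most $4-\lambda^2$.
  nlinarith

/-- A band of level `n + 2` inside the spectrum of level `n` contains two bands of level `n + 4`. -/
theorem exists_two_skip_bands {lam : ℝ} (hl : 4 < lam) (n : ℕ) {a b : ℝ}
    (h : IsCrossing (tr lam (n + 2)) a b) (h' : ∀ E ∈ Icc a b, |tr lam n E| ≤ 2) :
    ∃ T : Finset (ℝ × ℝ), T.card = 2 ∧ IsBandFamily lam (n + 4) (n + 2) T ∧
      ∀ q ∈ T, Icc q.1 q.2 ⊆ Icc a b := by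
  -- The level $n+3$ band $[c,d]$ separates the two bands sought: relative to level $n+1$, whose
  -- sign is constant on $[a,b]$, level $n+4$ has the same sign at $a,b$ and the opposite sign at
  -- $c,d$. It therefore crosses in $(a,c)$ and in $(d,b)$.
  obtain ⟨c, d, hc, hd, hcd⟩ := h.exists_next hl n h'
  have ma := left_mem_Icc.2 h.lt.le
  have mb := right_mem_Icc.2 h.lt.le
  have mc : c ∈ Icc a b := ⟨hc.le, hcd.lt.le.trans hd.le⟩
  have md : d ∈ Icc a b := ⟨hc.le.trans hcd.lt.le, hd.le⟩
  have hy : ∀ E ∈ Icc a b, 2 < |tr lam (n + 1) E| :=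
    fun E hE => two_lt_abs_middle hl (h' E hE) (h.abs_le_two E hE)
  have hsgn := fun {c d : ℝ} => mul_pos_of_two_lt_abs (c := c) (d := d)
    (continuous_tr lam (n + 1)) hy
  obtain ⟨ta, sa⟩ := tr_mul_pos_of_sq hl h.sq_left (h' a ma)
  obtain ⟨tb, sb⟩ := tr_mul_pos_of_sq hl h.sq_right (h' b mb)
  have zc := hcd.abs_le_two c (left_mem_Icc.2 hcd.lt.le)
  have zd := hcd.abs_le_two d (right_mem_Icc.2 hcd.lt.le)
  have tc : 2 < |tr lam (n + 4) c| := two_lt_abs_succ (n := n + 2) hl (h.abs_le_two c mc) zc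
  have td : 2 < |tr lam (n + 4) d| := two_lt_abs_succ (n := n + 2) hl (h.abs_le_two d md) zd
  have sc : tr lam (n + 4) c * tr lam (n + 1) c < 0 :=
    tr_mul_neg (n := n + 1) hl (h.abs_le_two c mc) zc
  have sd : tr lam (n + 4) d * tr lam (n + 1) d < 0 :=
    tr_mul_neg (n := n + 1) hl (h.abs_le_two d md) zd
  have opp : ∀ {s t y z : ℝ}, 0 < s * y → t * z < 0 → 0 < y * z → s * t < 0 := by
    intro s t y z h1 h2 h3
    by_contra! h4
    nlinarith [mul_neg_of_pos_of_neg h1 h2, mul_nonneg h4 h3.le]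
  obtain ⟨a₁, b₁, ha₁, hb₁, h₁⟩ := exists_isCrossing (continuous_tr lam (n + 4)) hc ta tc
    (opp sa sc (hsgn ma mc))
  obtain ⟨a₂, b₂, ha₂, hb₂, h₂⟩ := exists_isCrossing (continuous_tr lam (n + 4)) hd td tb
    (by rw [mul_comm]; exact opp sb sd (hsgn mb md))
  have hs₁ : Icc a₁ b₁ ⊆ Icc a b := Icc_subset_Icc ha₁.le (hb₁.le.trans mc.2)
  have hs₂ : Icc a₂ b₂ ⊆ Icc a b := Icc_subset_Icc (md.1.trans ha₂.le) hb₂.le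
  have hdisj : Disjoint (Icc a₁ b₁) (Icc a₂ b₂) := by
    rw [Set.disjoint_left]
    intro E hE hE'
    linarith [hE.2, hE'.1, hcd.lt]
  have f₁ : IsBandFamily lam (n + 4) (n + 2) {(a₁, b₁)} :=
    isBandFamily_singleton h₁ fun E hE => h.abs_le_two E (hs₁ hE)
  have f₂ : IsBandFamily lam (n + 4) (n + 2) {(a₂, b₂)} :=
    isBandFamily_singleton h₂ fun E hE => h.abs_le_two E (hs₂ hE)
  classical
  obtain ⟨u1, u2, u3⟩ := f₁.union f₂ (by simpa using hdisj)
  refine ⟨_, u1, ⟨u2, ?_, u3⟩, ?_⟩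
  · intro p hp
    exact (Finset.mem_union.1 hp).elim (f₁.abs_le_two p) (f₂.abs_le_two p)
  · intro p hp
    rcases Finset.mem_union.1 hp with hp | hp <;> rw [Finset.mem_singleton.1 hp] <;> assumption

/-- A common energy would lie in three consecutive spectra. -/
theorem disjoint_of_adjacent_of_skip {lam : ℝ} (hl : 4 < lam) {n : ℕ} {S T : Finset (ℝ × ℝ)}
    (hS : IsBandFamily lam (n + 2) (n + 1) S) (hT : IsBandFamily lam (n + 2) n T) :
    ∀ p ∈ S, ∀ q ∈ T, Disjoint (Icc p.1 p.2) (Icc q.1 q.2) := by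
  intro p hp q hq
  rw [Set.disjoint_left]
  intro E hE hE'
  exact absurd (hS.abs_le_two p hp E hE) (not_le.2 (two_lt_abs_middle hl (hT.abs_le_two q hq E hE')
    ((hS.crossing p hp).abs_le_two E hE)))

/-- Adjacent bands come one from each skip band a level below. Skip bands come, from two levels
below, one from each adjacent band and two from each skip band:
$\mathrm{fib}(n)+2\,\mathrm{fib}(n+1)=\mathrm{fib}(n+3)$. -/
theorem exists_bandFamilies {lam : ℝ} (hl : 4 < lam) (n : ℕ) :
    (∃ S, IsBandFamily lam (n + 2) (n + 1) S ∧ S.card = Nat.fib n) ∧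
    (∃ S, IsBandFamily lam (n + 2) n S ∧ S.card = Nat.fib (n + 1)) := by
  classical
  induction n using Nat.strong_induction_on with
  | _ n ih =>
    rcases n with _ | n
    · refine ⟨⟨∅, ⟨by simp, by simp, by simp⟩, rfl⟩, {(lam - 2, lam + 2)},
        isBandFamily_singleton ⟨by linarith, fun E hE => ?_, ?_⟩ fun E hE => ?_, rfl⟩
      · rw [tr_two, abs_le]
        exact ⟨by linarith [hE.1], by linarith [hE.2]⟩
      · rw [tr_two, tr_two]; ring
      · rw [tr_zero, abs_two]
    constructor
    · obtain ⟨S, hS, hc⟩ := (ih n (Nat.lt_succ_self n)).2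
      obtain ⟨T, hT, hf, -⟩ := hS.refine fun p hp =>
        exists_next_band hl n (hS.crossing p hp) (hS.abs_le_two p hp)
      exact ⟨T, hf, by rw [hT, hc, one_mul]⟩
    · rcases n with _ | n
      -- The parent two levels below level 3 is the level 1 band $[-2,2]$, which precedes the
      -- families of the induction.
      · have hc : IsCrossing (tr lam 1) (-2) 2 := by
          refine ⟨by norm_num, fun E hE => ?_, ?_⟩
          · rw [tr_one, abs_le]; exact hE
          · rw [tr_one, tr_one]; norm_num
        obtain ⟨T, hT, hf, -⟩ := exists_skip_band hl 0 hc fun E _ => by rw [tr_zero, abs_two]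
        exact ⟨T, hf, hT⟩
      · obtain ⟨⟨S, hS, hSc⟩, S', hS', hSc'⟩ := ih n (by omega)
        obtain ⟨T, hT, hf, hsub⟩ := hS.refine fun p hp =>
          exists_skip_band hl (n + 1) (hS.crossing p hp) (hS.abs_le_two p hp)
        obtain ⟨T', hT', hf', hsub'⟩ := hS'.refine fun p hp =>
          exists_two_skip_bands hl n (hS'.crossing p hp) (hS'.abs_le_two p hp)
        obtain ⟨u1, u2, u3⟩ := hf.union hf' fun q hq q' hq' => by
          obtain ⟨p, hp, hs⟩ := hsub q hq
          obtain ⟨p', hp', hs'⟩ := hsub' q' hq'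
          exact (disjoint_of_adjacent_of_skip hl hS hS' p hp p' hp').mono hs hs'
        refine ⟨T ∪ T', ⟨u2, fun p hp => ?_, u3⟩, ?_⟩
        · exact (Finset.mem_union.1 hp).elim (hf.abs_le_two p) (hf'.abs_le_two p)
        · rw [u1, hT, hT', hSc, hSc', Nat.fib_add_two (n := n + 1), Nat.fib_add_two (n := n)]
          ring

/-! ### The spectrum as a union of bands -/

theorem exists_bands {lam : ℝ} (hl : 4 < lam) (n : ℕ) :
    ∃ S : Finset (ℝ × ℝ), S.card = Nat.fib (n + 2) ∧
      (∀ p ∈ S, IsCrossing (tr lam (n + 2)) p.1 p.2) ∧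
      (S : Set (ℝ × ℝ)).PairwiseDisjoint (fun p => Icc p.1 p.2) := by
  classical
  obtain ⟨⟨S, hS, hSc⟩, S', hS', hSc'⟩ := exists_bandFamilies hl n
  obtain ⟨u1, u2, u3⟩ := hS.union hS' (disjoint_of_adjacent_of_skip hl hS hS')
  exact ⟨S ∪ S', by rw [u1, hSc, hSc', Nat.fib_add_two], u2, u3⟩

open Polynomial in
theorem setOf_abs_tr_le_eq {lam : ℝ} {n : ℕ} {S : Finset (ℝ × ℝ)} (hc : S.card = Nat.fib (n + 2))
    (hS : ∀ p ∈ S, IsCrossing (tr lam (n + 2)) p.1 p.2)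
    (hd : (S : Set (ℝ × ℝ)).PairwiseDisjoint (fun p => Icc p.1 p.2)) :
    {E | |tr lam (n + 2) E| ≤ 2} = ⋃ p ∈ S, Icc p.1 p.2 := by
  classical
  ext E
  simp only [mem_ofPred_eq, mem_iUnion, exists_prop]
  refine ⟨fun hE => ?_, fun ⟨p, hp, hE⟩ => (hS p hp).abs_le_two E hE⟩
  by_contra! hout
  -- Every band attains the value at $E$, so an $E$ outside all bands would give the polynomial one
  -- root more than its degree.
  have hroot : ∀ p ∈ S, ∃ r ∈ Icc p.1 p.2, tr lam (n + 2) r = tr lam (n + 2) E :=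
    fun p hp => (hS p hp).exists_eq (continuous_tr lam (n + 2)) hE
  choose! r hr hrE using hroot
  have hinj : Set.InjOn r S := by
    intro p hp q hq hpq
    by_contra hne
    exact (hd hp hq hne).le_bot ⟨hr p hp, hpq ▸ hr q hq⟩
  have hEnot : E ∉ S.image r := by
    intro hmem
    obtain ⟨p, hp, rfl⟩ := Finset.mem_image.1 hmem
    exact hout p hp (hr p hp)
  obtain ⟨-, -, -, hm, hdeg⟩ := natDegree_tracePoly lam n
  have hpos : 0 < (tracePoly lam (n + 2)).natDegree := by rw [hdeg]; exact Nat.fib_pos.2 (by omega)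
  set Q := tracePoly lam (n + 2) - C (tr lam (n + 2) E) with hQ
  have hQ0 : Q ≠ 0 := by
    intro h0
    have := natDegree_sub_C (p := tracePoly lam (n + 2)) (a := tr lam (n + 2) E)
    rw [← hQ, h0, natDegree_zero] at this
    omega
  have hsub : insert E (S.image r) ⊆ Q.roots.toFinset := by
    intro e he
    rw [Multiset.mem_toFinset, mem_roots hQ0, IsRoot.def, hQ, eval_sub, eval_C, sub_eq_zero]
    rcases Finset.mem_insert.1 he with rfl | he
    · rfl
    · obtain ⟨p, hp, rfl⟩ := Finset.mem_image.1 he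
      exact hrE p hp
  have h1 := (Finset.card_le_card hsub).trans (Multiset.toFinset_card_le _)
  have h2 := h1.trans (card_roots' Q)
  rw [Finset.card_insert_of_notMem hEnot, Finset.card_image_of_injOn hinj, hc, hQ, natDegree_sub_C,
    hdeg] at h2
  omega

theorem le_length {lam : ℝ} (hl : 4 < lam) (n : ℕ) {a b : ℝ}
    (h : IsCrossing (tr lam (n + 2)) a b) : 4 / (2 * lam + 22) ^ n ≤ b - a := by
  have hb : |tr lam (n + 2) b - tr lam (n + 2) a| = 4 := by
    rcases h.cases with ⟨h1, h2⟩ | ⟨h1, h2⟩ <;> rw [h1, h2] <;> norm_num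
  have hmvt := (convex_Icc a b).norm_image_sub_le_of_norm_hasDerivWithin_le
    (f := tr lam (n + 2)) (f' := tr' lam (n + 2)) (C := (2 * lam + 22) ^ n)
    (fun E _ => (hasDerivAt_tr lam (n + 2) E).hasDerivWithinAt)
    (fun E hE => abs_tr'_le_derivBound hl E (n + 2) (h.abs_le_two E hE))
    (left_mem_Icc.2 h.lt.le) (right_mem_Icc.2 h.lt.le)
  rw [Real.norm_eq_abs, Real.norm_eq_abs, hb, abs_of_pos (sub_pos.2 h.lt)] at hmvt
  rw [div_le_iff₀' (pow_pos (by linarith) n)]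
  exact hmvt

end FibHam

end

noncomputable section

namespace FibHam

/-! ### Diophantine properties of the golden mean -/

theorem ω_sq : ω ^ 2 = 1 - ω := by
  have h : Real.sqrt 5 ^ 2 = 5 := Real.sq_sqrt (by norm_num)
  unfold ω
  linear_combination h / 4

theorem ω_pos : 0 < ω := by
  have h : (1 : ℝ) < Real.sqrt 5 := by
    rw [Real.lt_sqrt (by norm_num)]; norm_num
  unfold ω
  linarith

theorem ω_lt_one : ω < 1 := by nlinarith [ω_sq, ω_pos]

theorem half_lt_ω : 1 / 2 < ω := by nlinarith [ω_sq, ω_pos]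

theorem ω_lt_two_thirds : ω < 2 / 3 := by nlinarith [ω_sq, ω_pos]

/-- The deviation of `fib (k + 1) * ω` from the integer `fib k`. -/
theorem fib_succ_mul_ω (k : ℕ) :
    (Nat.fib (k + 1) : ℝ) * ω - Nat.fib k = (-1) ^ k * ω ^ (k + 1) := by
  induction k with
  | zero => simp
  | succ k ih =>
    rw [Nat.fib_add_two]
    push_cast
    have e : (-1 : ℝ) ^ (k + 1) * ω ^ (k + 1 + 1) = -ω * ((-1) ^ k * ω ^ (k + 1)) := by ring
    rw [e, ← ih]
    linear_combination (Nat.fib (k + 1) : ℝ) * ω_sq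

theorem inv_ω_pow_le_fib (n : ℕ) :
    (ω⁻¹) ^ n ≤ (Nat.fib (n + 2) : ℝ) ∧ (ω⁻¹) ^ (n + 1) ≤ (Nat.fib (n + 3) : ℝ) := by
  have hω := ω_pos
  induction n with
  | zero =>
    refine ⟨by simp, ?_⟩
    have : ((Nat.fib 3 : ℕ) : ℝ) = 2 := by norm_num [Nat.fib]
    rw [zero_add, pow_one, this, inv_le_comm₀ hω (by norm_num)]
    linarith [half_lt_ω]
  | succ n ih =>
    refine ⟨ih.2, ?_⟩
    have e : (ω⁻¹) ^ (n + 1 + 1) = (ω⁻¹) ^ n + (ω⁻¹) ^ (n + 1) := by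
      have : (ω⁻¹) ^ 2 = 1 + ω⁻¹ := by
        field_simp
        linear_combination -ω_sq
      rw [pow_add _ n 1, add_assoc, one_add_one_eq_two, pow_add, this]; ring
    have e' : (Nat.fib (n + 1 + 3) : ℝ) = Nat.fib (n + 2) + Nat.fib (n + 3) := by
      exact_mod_cast Nat.fib_add_two (n := n + 2)
    rw [e, e']
    exact add_le_add ih.1 ih.2

theorem fib_det (k : ℕ) :
    (Nat.fib (k + 1) : ℤ) ^ 2 - Nat.fib k * Nat.fib (k + 2) = (-1) ^ k := by
  induction k with
  | zero => simp
  | succ k ih =>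
    have h1 : (Nat.fib (k + 1 + 2) : ℤ) = Nat.fib (k + 1) + Nat.fib (k + 2) := by
      exact_mod_cast Nat.fib_add_two (n := k + 1)
    have h0 : (Nat.fib (k + 2) : ℤ) = Nat.fib k + Nat.fib (k + 1) := by
      exact_mod_cast Nat.fib_add_two (n := k)
    rw [h1, show k + 1 + 1 = k + 2 from rfl, pow_succ (-1 : ℤ) k, ← ih, h0]
    ring

/-- The convergents of `ω` are best approximations. -/
theorem pow_le_abs_mul_ω_sub (k : ℕ) {n : ℤ} (m : ℤ) (hn : 0 < n) (hn' : n < Nat.fib (k + 2)) :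
    ω ^ (k + 1) ≤ |(n : ℝ) * ω - m| := by
  have hω := ω_pos
  obtain ⟨s, hs, hdet⟩ : ∃ s : ℤ, s * s = 1 ∧
      (Nat.fib (k + 1) : ℤ) ^ 2 - Nat.fib k * Nat.fib (k + 2) = s :=
    ⟨(-1) ^ k, by rw [← mul_pow]; simp, fib_det k⟩
  -- These are the coordinates of $(n,m)$ in the unimodular basis of two consecutive convergents.
  -- The range of $n$ forces $b=0$ or $a,b$ of opposite signs, so nothing cancels in $a-b\omega$.
  obtain ⟨a, ha⟩ : ∃ a : ℤ, a = s * (Nat.fib (k + 1) * n - Nat.fib (k + 2) * m) := ⟨_, rfl⟩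
  obtain ⟨b, hb⟩ : ∃ b : ℤ, b = s * (Nat.fib (k + 1) * m - Nat.fib k * n) := ⟨_, rfl⟩
  have en : n = a * Nat.fib (k + 1) + b * Nat.fib (k + 2) := by
    rw [ha, hb]; linear_combination -n * hs - s * n * hdet
  have em : m = a * Nat.fib k + b * Nat.fib (k + 1) := by
    rw [ha, hb]; linear_combination -m * hs - s * m * hdet
  have e : (n : ℝ) * ω - m = (-1) ^ k * ω ^ (k + 1) * (a - b * ω) := by
    have h0 := fib_succ_mul_ω k
    have h1 := fib_succ_mul_ω (k + 1)
    rw [en, em]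
    push_cast
    linear_combination (a : ℝ) * h0 + (b : ℝ) * h1
  have p1 : (0 : ℤ) < Nat.fib (k + 1) := by exact_mod_cast Nat.fib_pos.2 (Nat.succ_pos k)
  have p2 : (0 : ℤ) < Nat.fib (k + 2) := by exact_mod_cast Nat.fib_pos.2 (Nat.succ_pos (k + 1))
  have key : 1 ≤ |(a : ℝ) - b * ω| := by
    rcases lt_trichotomy b 0 with hb | hb | hb
    · have ha1 : 1 ≤ a := by
        by_contra! h
        nlinarith
      have ha1 : (1 : ℝ) ≤ a := by exact_mod_cast ha1
      have hb1 : (b : ℝ) < 0 := by exact_mod_cast hb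
      exact le_abs.2 (Or.inl (by nlinarith))
    · have ha1 : 1 ≤ a := by
        by_contra! h
        rw [hb] at en
        nlinarith
      have ha1 : (1 : ℝ) ≤ a := by exact_mod_cast ha1
      rw [hb]
      exact le_abs.2 (Or.inl (by simpa using ha1))
    · have ha1 : a ≤ -1 := by
        by_contra! h
        nlinarith
      have ha1 : (a : ℝ) ≤ -1 := by exact_mod_cast ha1
      have hb1 : (0 : ℝ) < b := by exact_mod_cast hb
      exact le_abs.2 (Or.inr (by nlinarith))
  rw [e, abs_mul, abs_mul, abs_pow, abs_neg, abs_one, one_pow, one_mul,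
    abs_of_pos (pow_pos hω (k + 1))]
  exact le_mul_of_one_le_right (pow_pos hω (k + 1)).le key

/-- Modulo integers the shift moves $n\omega$ by $\pm\omega^{k+1}$, and $n\omega$ is at least that
far from every integer. -/
theorem floor_add_fib_mul_ω (k : ℕ) {n : ℤ} (hn : 0 < n) (hn' : n < Nat.fib (k + 2)) :
    ⌊((n + Nat.fib (k + 1) : ℤ) : ℝ) * ω⌋ = ⌊(n : ℝ) * ω⌋ + Nat.fib k := by
  have h := fib_succ_mul_ω k
  have h0 := pow_le_abs_mul_ω_sub k ⌊(n : ℝ) * ω⌋ hn hn'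
  have h1 := pow_le_abs_mul_ω_sub k (⌊(n : ℝ) * ω⌋ + 1) hn hn'
  have f0 := Int.floor_le ((n : ℝ) * ω)
  have f1 := Int.lt_floor_add_one ((n : ℝ) * ω)
  have hp := pow_pos ω_pos (k + 1)
  rw [abs_of_nonneg (by linarith)] at h0
  rw [abs_of_neg (by push_cast; linarith)] at h1
  push_cast at h1
  -- An upward shift landing exactly on an integer is the boundary case; best approximation at the
  -- larger index `k + 3` excludes it.
  have hne : (n : ℝ) * ω ≠ ⌊(n : ℝ) * ω⌋ + 1 - ω ^ (k + 1) ∨ (-1 : ℝ) ^ k ≠ 1 := by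
    by_contra! hc
    obtain ⟨hc, hk⟩ := hc
    have hz : (((n + Nat.fib (k + 1) : ℤ) : ℝ)) * ω
        = ((⌊(n : ℝ) * ω⌋ + 1 + Nat.fib k : ℤ) : ℝ) := by
      rw [hk] at h
      push_cast
      linarith
    have := pow_le_abs_mul_ω_sub (k + 3) (⌊(n : ℝ) * ω⌋ + 1 + Nat.fib k)
      (n := n + Nat.fib (k + 1)) (by positivity) (by
        have e : Nat.fib (k + 3 + 2) = Nat.fib (k + 3) + Nat.fib (k + 4) := Nat.fib_add_two
        have e3 : Nat.fib (k + 3) = Nat.fib (k + 1) + Nat.fib (k + 2) := Nat.fib_add_two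
        have e4 : 0 < Nat.fib (k + 4) := Nat.fib_pos.2 (by omega)
        omega)
    rw [hz, sub_self, abs_zero] at this
    linarith [pow_pos ω_pos (k + 3 + 1)]
  rw [Int.floor_eq_iff]
  push_cast
  rcases neg_one_pow_eq_or ℝ k with hk | hk
  · rw [hk] at h
    have hne := hne.resolve_right (not_not.2 hk)
    have : (n : ℝ) * ω < ⌊(n : ℝ) * ω⌋ + 1 - ω ^ (k + 1) := lt_of_le_of_ne (by linarith) hne
    constructor <;> linarith
  · rw [hk] at h
    constructor <;> linarith

/-! ### The transfer matrices -/

/-- Expressed through increments of $\lfloor n\omega\rfloor$, shift invariance of the potential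
becomes a statement about floors. -/
theorem V_eq_ite (lam : ℝ) (n : ℤ) :
    V lam n = if ⌊((n + 1 : ℤ) : ℝ) * ω⌋ = ⌊(n : ℝ) * ω⌋ + 1 then lam else 0 := by
  have h0 := Int.floor_le ((n : ℝ) * ω)
  have h1 := Int.lt_floor_add_one ((n : ℝ) * ω)
  have hω := ω_pos
  have hω1 := ω_lt_one
  have hfr : Int.fract ((n : ℝ) * ω) = n * ω - ⌊(n : ℝ) * ω⌋ := rfl
  have hiff : Int.fract ((n : ℝ) * ω) ∈ Set.Ico (1 - ω) 1
      ↔ ⌊((n + 1 : ℤ) : ℝ) * ω⌋ = ⌊(n : ℝ) * ω⌋ + 1 := by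
    rw [Int.floor_eq_iff, hfr, Set.mem_Ico]
    push_cast
    constructor
    · rintro ⟨a, b⟩
      constructor <;> linarith
    · rintro ⟨a, b⟩
      constructor <;> linarith
  unfold V
  split_ifs with h
  · rw [Set.indicator_of_mem (hiff.2 h), mul_one]
  · rw [Set.indicator_of_notMem (fun h' => h (hiff.1 h')), mul_zero]

theorem V_add_fib (lam : ℝ) (k : ℕ) {n : ℤ} (hn : 0 < n) (hn' : n + 1 < Nat.fib (k + 2)) :
    V lam (n + Nat.fib (k + 1)) = V lam n := by
  have h0 := floor_add_fib_mul_ω k hn (by omega)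
  have h1 := floor_add_fib_mul_ω k (n := n + 1) (by omega) hn'
  rw [V_eq_ite, V_eq_ite, h0, show n + (Nat.fib (k + 1) : ℤ) + 1 = n + 1 + Nat.fib (k + 1) by ring,
    h1]
  congr 1
  rw [eq_iff_iff]
  constructor <;> intro h <;> linarith

theorem V_one (lam : ℝ) : V lam 1 = lam := by
  rw [V_eq_ite, if_pos]
  have h1 : ⌊((1 : ℤ) : ℝ) * ω⌋ = 0 := by
    rw [Int.floor_eq_iff]
    push_cast
    constructor <;> linarith [ω_pos, ω_lt_one]
  rw [h1, Int.floor_eq_iff]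
  push_cast
  constructor <;> linarith [half_lt_ω, ω_lt_one]

theorem V_two (lam : ℝ) : V lam 2 = 0 := by
  rw [V_eq_ite, if_neg]
  have h1 : ⌊((2 : ℤ) : ℝ) * ω⌋ = 1 := by
    rw [Int.floor_eq_iff]
    push_cast
    constructor <;> linarith [half_lt_ω, ω_lt_one]
  rw [h1, Int.floor_eq_iff]
  push_cast
  intro h
  linarith [h.1, ω_lt_two_thirds]

theorem stepProd_add (lam E : ℝ) (m : ℤ) (i j : ℕ) :
    stepProd lam E m (i + j) = stepProd lam E (m + i) j * stepProd lam E m i := by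
  induction j with
  | zero => simp [stepProd]
  | succ j ih =>
    rw [← add_assoc, stepProd, stepProd, ih, ← mul_assoc]
    congr 3
    push_cast
    ring

theorem stepProd_congr (lam E : ℝ) {m m' : ℤ} {j : ℕ}
    (h : ∀ i : ℕ, i < j → V lam (m + (i + 1 : ℕ)) = V lam (m' + (i + 1 : ℕ))) :
    stepProd lam E m j = stepProd lam E m' j := by
  induction j with
  | zero => rfl
  | succ j ih =>
    rw [stepProd, stepProd, ih fun i hi => h i (by omega), A, A, h j (Nat.lt_succ_self j)]

theorem det_stepProd (lam E : ℝ) (m : ℤ) (j : ℕ) : (stepProd lam E m j).det = 1 := by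
  induction j with
  | zero => simp [stepProd]
  | succ j ih => rw [stepProd, Matrix.det_mul, ih, A, Matrix.det_fin_two_of]; ring

theorem M_eq_stepProd (lam : ℝ) (k : ℕ) (E : ℝ) :
    M lam k E = stepProd lam E 0 (Nat.fib (k + 1)) := by
  rw [M, T, if_pos (by positivity), sub_zero, Int.toNat_natCast, F]

theorem M_one (lam E : ℝ) : M lam 1 E = !![E - lam, -1; 1, 0] := by
  rw [M_eq_stepProd]
  simp [stepProd, A, V_one]

/-- Here $M_0=M_1$, so the free step, of trace $E$, takes the place of a zeroth matrix in starting
the trace recursion. -/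
theorem M_two (lam E : ℝ) : M lam 2 E = !![E, -1; 1, 0] * M lam 1 E := by
  rw [M_one, M_eq_stepProd, show Nat.fib (2 + 1) = 2 from rfl]
  simp [stepProd, A, V_one, V_two]

/-- The last $F_{k+1}$ sites carry a copy of the potential on the first $F_{k+1}$ sites. -/
theorem M_rec (lam : ℝ) (k : ℕ) (E : ℝ) : M lam (k + 3) E = M lam (k + 1) E * M lam (k + 2) E := by
  have e : Nat.fib (k + 3 + 1) = Nat.fib (k + 2 + 1) + Nat.fib (k + 1 + 1) := by
    rw [Nat.fib_add_two, add_comm]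
  rw [M_eq_stepProd, M_eq_stepProd, M_eq_stepProd, e, stepProd_add]
  congr 1
  refine stepProd_congr lam E fun i hi => ?_
  rw [add_comm (0 + _) _, zero_add, zero_add]
  refine V_add_fib lam (k + 2) (by positivity) ?_
  have e2 : Nat.fib (k + 2 + 2) = Nat.fib (k + 2) + Nat.fib (k + 3) := Nat.fib_add_two
  have e3 : Nat.fib (k + 3) = Nat.fib (k + 1) + Nat.fib (k + 2) := Nat.fib_add_two
  have p1 : 0 < Nat.fib (k + 1) := Nat.fib_pos.2 (by omega)
  have hi : i < Nat.fib (k + 2) := hi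
  push_cast
  omega

theorem det_M (lam : ℝ) (k : ℕ) (E : ℝ) : (M lam k E).det = 1 := by
  rw [M_eq_stepProd, det_stepProd]

/-- Cayley–Hamilton, $P^2=(\operatorname{tr}P)P-1$, under the cyclic trace. -/
theorem trace_mul_mul {P Q : Matrix (Fin 2) (Fin 2) ℝ} (h : P.det = 1) :
    (P * (Q * P)).trace = (Q * P).trace * P.trace - Q.trace := by
  rw [Matrix.det_fin_two] at h
  simp only [Matrix.trace_fin_two, Matrix.mul_apply, Fin.sum_univ_two]
  linear_combination (-(Q 0 0) - Q 1 1) * h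

theorem x_one (lam E : ℝ) : x lam 1 E = E - lam := by
  rw [x, M_one, Matrix.trace_fin_two]; simp

theorem x_two (lam E : ℝ) : x lam 2 E = (E - lam) * E - 2 := by
  rw [x, M_two, M_one, Matrix.trace_fin_two]
  simp
  ring

theorem x_three (lam E : ℝ) : x lam 3 E = x lam 2 E * x lam 1 E - E := by
  rw [x, M_rec lam 0, M_two, trace_mul_mul (det_M lam 1 E), x, x, M_two]
  congr 1
  rw [Matrix.trace_fin_two]
  simp

theorem x_rec (lam : ℝ) (k : ℕ) (E : ℝ) :
    x lam (k + 4) E = x lam (k + 3) E * x lam (k + 2) E - x lam (k + 1) E := by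
  rw [x, M_rec lam (k + 1), show k + 1 + 2 = k + 3 from rfl, M_rec lam k,
    show k + 1 + 1 = k + 2 from rfl, trace_mul_mul (det_M lam (k + 2) E), ← M_rec]
  rfl

theorem x_eq_tr (lam E : ℝ) (n : ℕ) : x lam (n + 1) E = tr lam (n + 2) E ∧
    x lam (n + 2) E = tr lam (n + 3) E ∧ x lam (n + 3) E = tr lam (n + 4) E := by
  induction n with
  | zero =>
    have h3 : tr lam 3 E = (E - lam) * E - 2 := by rw [tr_rec, tr_two, tr_one, tr_zero]
    have h4 : tr lam 4 E = tr lam 3 E * tr lam 2 E - tr lam 1 E := tr_rec lam 1 E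
    refine ⟨by rw [x_one, tr_two], by rw [x_two, h3], ?_⟩
    rw [x_three, h4, h3, x_two, x_one, tr_two, tr_one]
  | succ n ih =>
    refine ⟨ih.2.1, ih.2.2, ?_⟩
    change x lam (n + 4) E = tr lam (n + 2 + 3) E
    rw [x_rec, tr_rec, ih.1, ih.2.1, ih.2.2]

theorem σ_succ_eq (lam : ℝ) (n : ℕ) : σ lam (n + 1) = {E | |tr lam (n + 2) E| ≤ 2} := by
  ext E
  rw [σ, Set.mem_ofPred_eq, Set.mem_ofPred_eq, (x_eq_tr lam E n).1]

/-! ### Lengths of the bands and measure of the spectrum -/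

theorem exists_band_intervals {lam : ℝ} (hl : 4 < lam) (n : ℕ) :
    ∃ a b : Fin (F (n + 1)) → ℝ,
      σ lam (n + 1) = ⋃ i, Set.Icc (a i) (b i) ∧
      (∀ i j, i ≠ j → Disjoint (Set.Icc (a i) (b i)) (Set.Icc (a j) (b j))) ∧
      (∀ i, a i ≤ b i) ∧ ∀ i, 4 / (2 * lam + 22) ^ n ≤ b i - a i := by
  obtain ⟨S, hc, hS, hd⟩ := exists_bands hl n
  let e : Fin (F (n + 1)) ≃ S := (S.equivFinOfCardEq hc).symm
  refine ⟨fun i => (e i).1.1, fun i => (e i).1.2, ?_, fun i j hij => ?_, fun i => ?_, fun i => ?_⟩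
  · rw [σ_succ_eq, setOf_abs_tr_le_eq hc hS hd,
      e.surjective.iUnion_comp (fun p : S => Set.Icc p.1.1 p.1.2), Set.iUnion_subtype]
  · exact hd (e i).2 (e j).2 fun h => hij (e.injective (Subtype.ext h))
  · exact (hS _ (e i).2).lt.le
  · exact le_length hl n (hS _ (e i).2)

/-- With $g=\gamma+1$ one has $\omega^{-g}=2\lambda+22$, so $F_{n+1}\ge\omega^{-n}$ gives
$F_{n+1}^{g}\ge(2\lambda+22)^n$. -/
theorem rpow_neg_γ_le {lam : ℝ} (hl : 4 < lam) (n : ℕ) :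
    (F (n + 1) : ℝ) ^ (-γ lam) ≤ F (n + 1) * (1 / (2 * lam + 22) ^ n) := by
  have hω : 1 < ω⁻¹ := (one_lt_inv₀ ω_pos).2 ω_lt_one
  have hω0 : 0 < ω⁻¹ := zero_lt_one.trans hω
  have hlog : 0 < Real.log ω⁻¹ := Real.log_pos hω
  have hS : 0 < 2 * lam + 22 := by linarith
  have hF : (ω⁻¹) ^ n ≤ (F (n + 1) : ℝ) := (inv_ω_pow_le_fib n).1
  have hF0 : (0 : ℝ) < F (n + 1) := (pow_pos hω0 n).trans_le hF
  set g := Real.log (2 * lam + 22) / Real.log ω⁻¹ with hg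
  have hg0 : 0 ≤ g := div_nonneg (Real.log_nonneg (by linarith)) hlog.le
  have hωg : (ω⁻¹) ^ g = 2 * lam + 22 := by
    rw [Real.rpow_def_of_pos hω0, hg, mul_div_cancel₀ _ hlog.ne', Real.exp_log hS]
  have hpow : (2 * lam + 22) ^ n ≤ (F (n + 1) : ℝ) ^ g := calc
    (2 * lam + 22) ^ n = ((ω⁻¹) ^ n) ^ g := by
      rw [← Real.rpow_natCast ω⁻¹, ← Real.rpow_mul hω0.le, mul_comm (n : ℝ), Real.rpow_mul hω0.le, hωg,
        Real.rpow_natCast]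
    _ ≤ _ := Real.rpow_le_rpow (pow_pos hω0 n).le hF hg0
  have e : -γ lam = 1 - g := by rw [γ, ← hg]; ring
  rw [e, Real.rpow_sub hF0, Real.rpow_one, div_eq_mul_one_div]
  gcongr

theorem le_volume_σ {lam : ℝ} (hl : 4 < lam) (n : ℕ) :
    ENNReal.ofReal (4 * (F (n + 1) : ℝ) ^ (-γ lam)) ≤ volume (σ lam (n + 1)) := by
  obtain ⟨a, b, hσ, hd, -, hlen⟩ := exists_band_intervals hl n
  rw [hσ, measure_iUnion (fun i j hij => hd i j hij) (fun i => measurableSet_Icc), tsum_fintype]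
  calc ENNReal.ofReal (4 * (F (n + 1) : ℝ) ^ (-γ lam))
      ≤ ENNReal.ofReal (F (n + 1) * (4 / (2 * lam + 22) ^ n)) := by
        apply ENNReal.ofReal_le_ofReal
        have := rpow_neg_γ_le hl n
        calc _ ≤ 4 * (F (n + 1) * (1 / (2 * lam + 22) ^ n)) := by gcongr
          _ = _ := by ring
    _ = ∑ _i : Fin (F (n + 1)), ENNReal.ofReal (4 / (2 * lam + 22) ^ n) := by
        rw [Finset.sum_const, Finset.card_univ, Fintype.card_fin, nsmul_eq_mul,
          ENNReal.ofReal_mul (Nat.cast_nonneg _), ENNReal.ofReal_natCast]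
    _ ≤ _ := by
        gcongr with i
        rw [Real.volume_Icc]
        exact ENNReal.ofReal_le_ofReal (hlen i)

end FibHam

end

theorem proposition2 :
    ∃ C : ℝ, 0 < C ∧ ∀ lam : ℝ, 4 < lam → ∀ k : ℕ,
      (∃ a b : Fin (FibHam.F k) → ℝ,
        FibHam.σ lam k = ⋃ i, Set.Icc (a i) (b i) ∧
        (∀ i j, i ≠ j → Disjoint (Set.Icc (a i) (b i)) (Set.Icc (a j) (b j))) ∧
        (∀ i, a i ≤ b i) ∧
        (∀ i, ENNReal.ofReal (4 / (C * (2 * lam + 22) ^ k)) ≤ volume (Set.Icc (a i) (b i)))) ∧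
      ENNReal.ofReal (4 / C * (FibHam.F k : ℝ) ^ (-FibHam.γ lam)) ≤ volume (FibHam.σ lam k) := by
  refine ⟨1, one_pos, fun lam hl k => ?_⟩
  rw [one_mul, div_one]
  rcases k with _ | n
  -- $F_0=F_1$ holds definitionally, so the data of $\sigma_1$ serve for $k=0$.
  · refine ⟨?_, FibHam.le_volume_σ hl 0⟩
    obtain ⟨a, b, hσ, hd, hab, hlen⟩ := FibHam.exists_band_intervals hl 0
    refine ⟨a, b, hσ, hd, hab, fun i => ?_⟩
    rw [Real.volume_Icc]
    exact ENNReal.ofReal_le_ofReal (hlen i)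
  · refine ⟨?_, FibHam.le_volume_σ hl n⟩
    obtain ⟨a, b, hσ, hd, hab, hlen⟩ := FibHam.exists_band_intervals hl n
    refine ⟨a, b, hσ, hd, hab, fun i => ?_⟩
    rw [Real.volume_Icc]
    -- The band estimate has exponent $n=k-1$, one power better than required.
    refine ENNReal.ofReal_le_ofReal (le_trans ?_ (hlen i))
    have h1 : 1 ≤ 2 * lam + 22 := by linarith
    have h0 : 0 < 2 * lam + 22 := by linarith
    gcongr
    exact Nat.le_succ n
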